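/- Fix an integer $m\ge 1$. The preferential attachment multigraph $G_n=G_n^m$ is defined inductively: $G_1$ is a single node with $m$ loops, and $G_n$ is obtained from $G_{n-1}$ by adding a new node $u$ together with $m$ edges $(u,v_1),\dots,(u,v_m)$, inserted one after the other. When the $i$-th of them is inserted, let $\deg$ be the current degrees (a loop counts twice) and $M_i$ the sum of the current degrees of all nodes, including $u$; then $v_i$ is a node $v\ne u$ with probability $\frac{\deg(v)}{M_i+1}$, and $v_i=u$ with probability $\frac{\deg(u)+1}{M_i+1}$. For a multigraph $G$ let $N_G(u)$ be the set of nodes joined to $u$ by at least one edge. Call a node of $G_n$ a low-degree node if its degree in $G_n$ is less than $\log^3 n$. Matching algorithm. Let $G_1',G_2'$ be two sub-multigraphs of $G_n$ (two copies of the network on the same nodes). A link is a pair $(u,v)$ with $u$ a node of $G_1'$ and $v$ a node of $G_2'$; it is correct if $u=v$. For a set $L$ of links, the score of a pair $(u,v)$ is its number of similarity witnesses, i.e. the number of links $(a,b)\in L$ with $a\in N_{G_1'}(u)$ and $b\in N_{G_2'}(v)$. The algorithm with minimum matching score $T$, $k$ iterations and degree parameter $D$ starts from a set of initial links and performs, $k$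 times in succession, the phases $j=\lfloor\log_2 D\rfloor,\dots,2,1$. Phase $j$ considers all pairs $(u,v)$ with $\deg_{G_1'}(u)\ge 2^j$ and $\deg_{G_2'}(v)\ge 2^j$, computes their scores with respect to the current set of links, and adds to the set those pairs $(u,v)$ whose score is at least $T$ and is the highest among all considered pairs in which $u$ or $v$ appears; ties may be resolved in any way. Then, with probability tending to $1$ as $n\to\infty$, $G_n$ has all of the following properties. 1. Any two distinct low-degree nodes $u,v$ satisfy $|N_{G_n}(u)\cap N_{G_n}(v)|\le 8$. 2. For all sub-multigraphs $G_1',G_2'$ of $G_n$ and every set $L$ of correct links, every pair $(u,v)$ of distinct low-degree nodes has score less than $9$. 3. For all sub-multigraphs $G_1',G_2'$ of $G_n$, all $k$ and $D$, and every run of the algorithm with minimum matching score $T=9$ from a set of correct initial links, low-degree nodes are never the first to be matched incorrectly: if after $t$ phases the set of links contains a pair $(u,v)$ of distinct low-degree nodes, then after some $t'<t$ phases it already contained an incorrect link with an endpoint that is not a low-degree node. -/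

import Mathlib

open Filter Topology
open scoped ENNReal

namespace PAMatching

/-- A finite multigraph (loops and parallel edges allowed) on nodes labelled by natural numbers,
given by its multiset of edges. A sub-multigraph is a sub-multiset. -/
abbrev Multigraph : Type := Multiset (Sym2 ℕ)

/-- The degree of a node: the number of edges at `u`, with every loop counted twice. -/
def deg (G : Multigraph) (u : ℕ) : ℕ :=
  G.countP (fun e => u ∈ e) + G.count s(u, u)

/-- The neighbourhood `N(u)`: the set of all nodes joined to `u` by at least one edge
(parallel edges count once; a node with a loop is a neighbour of itself). -/
def nbr (G : Multigraph) (u : ℕ) : Set ℕ := {w | s(u, w) ∈ G}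

theorem nbr_finite (G : Multigraph) (u : ℕ) : (nbr G u).Finite := by
  have h : {e : Sym2 ℕ | e ∈ G}.Finite :=
    G.toFinset.finite_toSet.subset (fun e he => by simpa using he)
  exact h.preimage (f := fun w => s(u, w)) (fun a _ b _ hab => Sym2.congr_right.mp hab)

/-! ### The preferential attachment model -/

/-- The weight with which node `v` is chosen as the second endpoint of an edge at the new
node `u`: its current degree, plus one if `v` is `u` itself. -/
def weight (G : Multigraph) (u v : ℕ) : ℕ := deg G v + if v = u then 1 else 0

/-- The sum of the degrees of the nodes `0, …, u`. -/
def degSum (G : Multigraph) (u : ℕ) : ℕ := ∑ v : Fin (u + 1), deg G v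

theorem sum_weight (G : Multigraph) (u : ℕ) :
    ∑ v : Fin (u + 1), (weight G u v : ℝ≥0∞) / ((degSum G u : ℝ≥0∞) + 1) = 1 := by
  have h : ∑ v : Fin (u + 1), weight G u v = degSum G u + 1 := by
    have h1 : ∀ v : Fin (u + 1), ((v : ℕ) = u) ↔ v = Fin.last u := by
      intro v; rw [Fin.ext_iff, Fin.val_last]
    simp [weight, degSum, Finset.sum_add_distrib, h1]
  have h2 : ∑ v : Fin (u + 1), (weight G u v : ℝ≥0∞) = (degSum G u : ℝ≥0∞) + 1 := by
    exact_mod_cast h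
  simp only [div_eq_mul_inv]
  rw [← Finset.sum_mul, h2]
  refine ENNReal.mul_inv_cancel (by simp) ?_
  exact ENNReal.add_ne_top.mpr ⟨ENNReal.natCast_ne_top _, ENNReal.one_ne_top⟩

/-- The random second endpoint of an edge inserted at the new node `u` into the current
multigraph `G` on the nodes `0, …, u`. With `M` the sum of all current degrees, the endpoint is
`v ≠ u` with probability `deg v / (M + 1)` and `u` with probability `(deg u + 1) / (M + 1)`. -/
noncomputable def target (G : Multigraph) (u : ℕ) : PMF (Fin (u + 1)) :=
  PMF.ofFintype (fun v => (weight G u v : ℝ≥0∞) / ((degSum G u : ℝ≥0∞) + 1)) (sum_weight G u)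

/-- Insert `i` edges at the new node `u`, one after the other, the degrees being updated after
each insertion. -/
noncomputable def addEdges (u : ℕ) : ℕ → Multigraph → PMF Multigraph
  | 0, G => PMF.pure G
  | i + 1, G => (addEdges u i G).bind fun H => (target H u).map fun v => s(u, (v : ℕ)) ::ₘ H

/-- The law of the preferential attachment multigraph `G_n^m` on the nodes `0, …, n - 1`, listed
in order of arrival: `G_1^m` is one node with `m` loops, and each further node arrives with `m`
edges. (`n = 0` gives the empty graph.) -/
noncomputable def prefAttach (m : ℕ) : ℕ → PMF Multigraph
  | 0 => PMF.pure 0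
  | 1 => PMF.pure (Multiset.replicate m s(0, 0))
  | n + 2 => (prefAttach m (n + 1)).bind (addEdges (n + 1) m)

/-! ### The matching algorithm

`G₁` and `G₂` are the two copies; nodes with the same label in the two copies are copies of the
same node, so a link `(u, v)` is correct exactly when `u = v`. -/

/-- A set of links (identified pairs, first entry in `G₁`, second entry in `G₂`). -/
abbrev Links : Type := Set (ℕ × ℕ)

/-- The similarity witnesses of the pair `(u, v)`: linked pairs `(a, b)` with `a ∈ N₁(u)` and
`b ∈ N₂(v)`. -/
def witnesses (G₁ G₂ : Multigraph) (L : Links) (u v : ℕ) : Set (ℕ × ℕ) :=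
  {p | p.1 ∈ nbr G₁ u ∧ p.2 ∈ nbr G₂ v ∧ p ∈ L}

theorem witnesses_finite (G₁ G₂ : Multigraph) (L : Links) (u v : ℕ) :
    (witnesses G₁ G₂ L u v).Finite :=
  ((nbr_finite G₁ u).prod (nbr_finite G₂ v)).subset fun _ hp => ⟨hp.1, hp.2.1⟩

/-- The score of `(u, v)`: its number of similarity witnesses. -/
noncomputable def score (G₁ G₂ : Multigraph) (L : Links) (u v : ℕ) : ℕ :=
  (witnesses G₁ G₂ L u v).ncard

/-- `(u, v)` is considered in a phase with parameter `j`: both degrees are at least `2 ^ j`. -/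
def Candidate (G₁ G₂ : Multigraph) (j u v : ℕ) : Prop :=
  2 ^ j ≤ deg G₁ u ∧ 2 ^ j ≤ deg G₂ v

/-- `(u, v)` is a candidate with score at least `T`, and no candidate pair in which `u` or `v`
appears has a higher score. -/
def IsBest (G₁ G₂ : Multigraph) (T j : ℕ) (L : Links) (u v : ℕ) : Prop :=
  Candidate G₁ G₂ j u v ∧ T ≤ score G₁ G₂ L u v ∧
    ∀ a b : ℕ, Candidate G₁ G₂ j a b → (a = u ∨ b = v) →
      score G₁ G₂ L a b ≤ score G₁ G₂ L u v

/-- As `IsBest`, and all other candidate pairs in which `u` or `v` appears have a strictly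
smaller score. -/
def IsUniqueBest (G₁ G₂ : Multigraph) (T j : ℕ) (L : Links) (u v : ℕ) : Prop :=
  Candidate G₁ G₂ j u v ∧ T ≤ score G₁ G₂ L u v ∧
    ∀ a b : ℕ, Candidate G₁ G₂ j a b → (a = u ∨ b = v) → (a, b) ≠ (u, v) →
      score G₁ G₂ L a b < score G₁ G₂ L u v

/-- One phase, with degree bound `2 ^ j` and minimum matching score `T`, may turn the links `L`
into `L'`: only pairs of highest score are added, and every pair that has the highest score
without a tie is added. Ties may be resolved in any way. -/
def Phase (G₁ G₂ : Multigraph) (T j : ℕ) (L L' : Links) : Prop :=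
  ∃ S : Links, L' = L ∪ S ∧
    (∀ u v : ℕ, (u, v) ∈ S → IsBest G₁ G₂ T j L u v) ∧
    (∀ u v : ℕ, IsUniqueBest G₁ G₂ T j L u v → (u, v) ∈ S)

/-- The values of `j` in the successive phases: `k` times `⌊log₂ D⌋, …, 2, 1`. -/
def schedule (k D : ℕ) : List ℕ :=
  (List.replicate k (List.range' 1 (Nat.log 2 D)).reverse).flatten

/-- `ℓ 0, ℓ 1, …` are the sets of links after `0, 1, …` phases of a run of the matching algorithm
with minimum matching score `T`, `k` iterations and degree parameter `D`. -/
def IsRun (G₁ G₂ : Multigraph) (T k D : ℕ) (ℓ : ℕ → Links) : Prop :=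
  ∀ (t : ℕ) (ht : t < (schedule k D).length),
    Phase G₁ G₂ T ((schedule k D)[t]) (ℓ t) (ℓ (t + 1))

/-- All links in `L` identify a node with its own copy. -/
def AllCorrect (L : Links) : Prop := ∀ p ∈ L, p.1 = p.2

/-! ### Low-degree nodes -/

/-- Node `u` has degree less than `log³ n` in `G`. -/
def LowDegree (n : ℕ) (G : Multigraph) (u : ℕ) : Prop := (deg G u : ℝ) < Real.log n ^ 3

/-- Any two distinct nodes of degree less than `log³ n` have at most 8 common neighbours. -/
def FewCommonNeighbours (n : ℕ) (G : Multigraph) : Prop :=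
  ∀ u v : ℕ, u < n → v < n → u ≠ v → LowDegree n G u → LowDegree n G v →
    (nbr G u ∩ nbr G v).ncard ≤ 8

/-- For all sub-multigraphs `G₁, G₂` of `G` and all sets of correct links, the score of a pair
of distinct low-degree nodes stays below 9. -/
def ScoreBelowThreshold (n : ℕ) (G : Multigraph) : Prop :=
  ∀ G₁ G₂ : Multigraph, G₁ ≤ G → G₂ ≤ G → ∀ L : Links, AllCorrect L →
    ∀ u v : ℕ, u ≠ v → LowDegree n G u → LowDegree n G v → score G₁ G₂ L u v < 9

/-- For all sub-multigraphs `G₁, G₂` of `G`, in every run of the algorithm with minimum matching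
score 9 from correct initial links, low-degree nodes are never the first to be mismatched: if two
distinct low-degree nodes are linked after `t` phases, then already after some `t' < t` phases
there was an incorrect link with an endpoint that is not of low degree. -/
def NoLowDegreeError (n : ℕ) (G : Multigraph) : Prop :=
  ∀ G₁ G₂ : Multigraph, G₁ ≤ G → G₂ ≤ G → ∀ (k D : ℕ) (ℓ : ℕ → Links),
    AllCorrect (ℓ 0) → IsRun G₁ G₂ 9 k D ℓ →
    ∀ t ≤ (schedule k D).length, ∀ u v : ℕ,
      (u, v) ∈ ℓ t → u ≠ v → LowDegree n G u → LowDegree n G v →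
      ∃ t' < t, ∃ a b : ℕ, (a, b) ∈ ℓ t' ∧ a ≠ b ∧ (¬ LowDegree n G a ∨ ¬ LowDegree n G b)

end PAMatching

namespace PAMatching

/-! ### Degrees in a growing multigraph -/

/-! Put `N = ⌈log³ n⌉`. Property 1 can fail only if a node with label below `N` has low degree, or
if two nodes with labels at least `N` have nine common neighbours.

Old nodes: after `s` insertions the total degree is exactly `2s`, so expected degrees grow like `√s`
(`growth`). The same computation gives `E[1/deg x] = O(N n^(-1/4))` for `x < N`
(`expect_inv_deg_le`, `sqrt_growth_div_le`). Markov's inequality and a union bound then cost `O(log⁹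
n / n^(1/4))`.

Young nodes: a prescribed set of boundedly many edges `ab` is present with probability at most a
constant times `∏ 1/√((a+1)(b+1))` (`expect_prod_indicator_le`). The edges are dependent; a product
of potentials, one per edge, is a supermartingale (`stepAvg_gain_le`) and handles this. Hence `u`,
`v` share four prescribed neighbours `wᵢ` with probability `O(u⁻² v⁻² ∏ wᵢ⁻¹)` in shifted labels.
Summing over `u, v ≥ N` and all `wᵢ` gives `O(N⁻² log⁴ n) = O(log⁻² n)`; three neighbours would
leave a bound of constant order.

Properties 2 and 3 follow deterministically: correct links turn witnesses into common neighbours,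
and a low-degree mismatch with score 9 therefore needs an earlier incorrect link. -/

theorem deg_zero (x : ℕ) : deg 0 x = 0 := by simp [deg]

theorem deg_cons (G : Multigraph) (a b x : ℕ) :
    deg (s(a, b) ::ₘ G) x = deg G x + (if a = x then 1 else 0) + (if b = x then 1 else 0) := by
  unfold deg
  rw [Multiset.countP_cons, Multiset.count_cons]
  have h1 : (x ∈ s(a, b)) ↔ (a = x ∨ b = x) := by
    rw [Sym2.mem_iff]; constructor <;> (rintro (h | h) <;> simp [h])
  have h2 : (s(x, x) = s(a, b)) ↔ (a = x ∧ b = x) := by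
    rw [Sym2.eq_iff]; constructor
    · rintro (⟨h, h'⟩ | ⟨h, h'⟩) <;> simp [h.symm, h'.symm]
    · rintro ⟨h, h'⟩; simp [h, h']
  simp only [h1, h2]
  split_ifs <;> omega

/-- The multigraph whose edge number `i`, for `i < s`, joins the node `i / m` to `f i`. -/
def graphOf (m s : ℕ) (f : ℕ → ℕ) : Multigraph :=
  (Multiset.range s).map fun i => s(i / m, f i)

theorem graphOf_zero (m : ℕ) (f : ℕ → ℕ) : graphOf m 0 f = 0 := by simp [graphOf]

theorem graphOf_succ (m s : ℕ) (f : ℕ → ℕ) :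
    graphOf m (s + 1) f = s(s / m, f s) ::ₘ graphOf m s f := by
  simp [graphOf, Multiset.range_succ]

theorem graphOf_update (m s : ℕ) (f : ℕ → ℕ) (v : ℕ) :
    graphOf m s (Function.update f s v) = graphOf m s f := by
  refine Multiset.map_congr rfl fun i hi => ?_
  rw [Function.update_of_ne (Multiset.mem_range.mp hi).ne]

theorem graphOf_succ_update (m s : ℕ) (f : ℕ → ℕ) (v : ℕ) :
    graphOf m (s + 1) (Function.update f s v) = s(s / m, v) ::ₘ graphOf m s f := by
  rw [graphOf_succ, graphOf_update, Function.update_self]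

/-- The first `s` edges all go to nodes that are already present. -/
def Valid (m s : ℕ) (f : ℕ → ℕ) : Prop := ∀ i < s, f i ≤ i / m

theorem Valid.of_succ {m s : ℕ} {f : ℕ → ℕ} (h : Valid m (s + 1) f) : Valid m s f :=
  fun i hi => h i (by omega)

theorem Valid.update {m s : ℕ} {f : ℕ → ℕ} (h : Valid m s f) {v : ℕ} (hv : v ≤ s / m) :
    Valid m (s + 1) (Function.update f s v) := by
  intro i hi
  rcases eq_or_ne i s with rfl | hne
  · simpa using hv
  · rw [Function.update_of_ne hne]; exact h i (by omega)

theorem deg_graphOf_succ (m s : ℕ) (f : ℕ → ℕ) (x : ℕ) :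
    deg (graphOf m (s + 1) f) x
      = deg (graphOf m s f) x + (if s / m = x then 1 else 0) + (if f s = x then 1 else 0) := by
  rw [graphOf_succ, deg_cons]

theorem deg_graphOf_eq_zero {m s : ℕ} {f : ℕ → ℕ} (hf : Valid m s f) {x : ℕ} (hm : 1 ≤ m)
    (hs : s ≤ m * x) : deg (graphOf m s f) x = 0 := by
  induction s with
  | zero => rw [graphOf_zero, deg_zero]
  | succ s ih =>
    have h1 : s / m < x := (Nat.div_lt_iff_lt_mul hm).mpr (by rw [mul_comm]; omega)
    have h2 := hf s (by omega)
    rw [deg_graphOf_succ, ih hf.of_succ (by omega), if_neg (by omega), if_neg (by omega)]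

/-- Node `x` first appears with edge number `m * x`, and each edge adds at most 2. At `s = m * (x +
1)` this gives `2 * m`, the constant in `potential`. -/
theorem deg_graphOf_le {m s : ℕ} {f : ℕ → ℕ} (hf : Valid m s f) {x : ℕ} (hm : 1 ≤ m) :
    deg (graphOf m s f) x ≤ 2 * (s - m * x) := by
  induction s with
  | zero => rw [graphOf_zero, deg_zero]; omega
  | succ s ih =>
    rcases le_or_gt (s + 1) (m * x) with h | h
    · rw [deg_graphOf_eq_zero hf hm h]; omega
    · rw [deg_graphOf_succ]
      have := ih hf.of_succ
      split_ifs <;> omega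

theorem one_le_deg_graphOf {m s : ℕ} (f : ℕ → ℕ) {x : ℕ} (hm : 1 ≤ m) (hs : m * x < s) :
    1 ≤ deg (graphOf m s f) x := by
  induction s, hs using Nat.le_induction with
  | base =>
    rw [deg_graphOf_succ, if_pos (Nat.mul_div_cancel_left x hm)]; omega
  | succ s _ ih => rw [deg_graphOf_succ]; omega

theorem sum_fin_ite_eq {a u : ℕ} (ha : a ≤ u) :
    ∑ v : Fin (u + 1), (if a = (v : ℕ) then 1 else 0) = 1 := by
  rw [Finset.sum_eq_single (⟨a, by omega⟩ : Fin (u + 1))]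
  · simp
  · intro b _ hb
    rw [if_neg]; rintro rfl; exact hb rfl
  · simp

theorem sum_deg_graphOf {m s : ℕ} {f : ℕ → ℕ} (hf : Valid m s f) {u : ℕ}
    (hu : ∀ i < s, i / m ≤ u) : ∑ v : Fin (u + 1), deg (graphOf m s f) v = 2 * s := by
  induction s with
  | zero => simp [graphOf_zero, deg_zero]
  | succ s ih =>
    have h1 := hu s (by omega)
    have h2 := hf s (by omega)
    simp only [deg_graphOf_succ, Finset.sum_add_distrib]
    rw [ih hf.of_succ (fun i hi => hu i (by omega)), sum_fin_ite_eq h1, sum_fin_ite_eq (by omega)]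
    ring

/-- This makes the denominator of every attachment probability the deterministic number `2s + 1`. -/
theorem degSum_graphOf {m s : ℕ} {f : ℕ → ℕ} (hf : Valid m s f) :
    degSum (graphOf m s f) (s / m) = 2 * s :=
  sum_deg_graphOf hf fun _ hi => Nat.div_le_div_right hi.le

/-! ### The process as a sequence of edge insertions -/

/-- The law of the multigraph after `s` edge insertions. -/
noncomputable def edgeProcess (m : ℕ) : ℕ → PMF Multigraph
  | 0 => PMF.pure 0
  | s + 1 => (edgeProcess m s).bind fun H =>
      (target H (s / m)).map fun v : Fin (s / m + 1) => s(s / m, (v : ℕ)) ::ₘ H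

theorem addEdges_succ (u i : ℕ) (G : Multigraph) :
    addEdges u (i + 1) G = (addEdges u i G).bind fun H =>
      (target H u).map fun v : Fin (u + 1) => s(u, (v : ℕ)) ::ₘ H := by
  rw [addEdges]
  congr 1; funext H
  -- In `addEdges` the coercion to `ℕ` was elaborated on the whole `PMF`, as a bind with `pure`; it
  -- is merged into the map here.
  change PMF.map (fun v : ℕ => s(u, v) ::ₘ H)
    ((target H u).bind fun a => PMF.pure (a : ℕ)) = _
  rw [← Function.comp_def PMF.pure, PMF.bind_pure_comp, PMF.map_comp]
  rfl

theorem edgeProcess_add (m u i : ℕ) (hm : 1 ≤ m) (hi : i ≤ m) :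
    edgeProcess m (m * u + i) = (edgeProcess m (m * u)).bind (addEdges u i) := by
  induction i with
  | zero =>
    have : addEdges u 0 = PMF.pure := by funext G; rfl
    rw [this, PMF.bind_pure]; rfl
  | succ i ih =>
    have hd : (m * u + i) / m = u := by
      rw [Nat.mul_add_div hm, Nat.div_eq_of_lt (by omega), add_zero]
    rw [← add_assoc, edgeProcess]
    rw [ih (by omega), PMF.bind_bind]
    congr 1; funext G
    rw [addEdges_succ, hd]

/-- With a single node present the target is forced, so the prescribed start with `m` loops agrees
with inserting `m` edges into the empty graph. -/
theorem addEdges_zero_node (i : ℕ) (G : Multigraph) :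
    addEdges 0 i G = PMF.pure (Multiset.replicate i s(0, 0) + G) := by
  induction i with
  | zero => simp [addEdges]
  | succ i ih =>
    have : ∀ H : Multigraph, ((target H 0).map fun v : Fin (0 + 1) => s(0, (v : ℕ)) ::ₘ H)
        = PMF.pure (s(0, 0) ::ₘ H) := by
      intro H
      have : (fun v : Fin (0 + 1) => s(0, (v : ℕ)) ::ₘ H)
          = Function.const _ (s(0, 0) ::ₘ H) := by
        funext v
        simp
      rw [this, PMF.map_const]
    rw [addEdges_succ, ih, PMF.pure_bind, this, Multiset.replicate_succ, Multiset.cons_add]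

theorem prefAttach_eq_edgeProcess (m n : ℕ) (hm : 1 ≤ m) :
    prefAttach m n = edgeProcess m (m * n) := by
  induction n with
  | zero => rfl
  | succ n ih =>
    rw [mul_add, mul_one, edgeProcess_add m n m hm le_rfl, ← ih]
    cases n with
    | zero => rw [prefAttach, prefAttach, PMF.pure_bind, addEdges_zero_node, add_zero]
    | succ n => rfl

/-- The average of `F` over the choice of the target of edge number `s`. -/
noncomputable def stepAvg (m s : ℕ) (F : (ℕ → ℕ) → ℝ) (f : ℕ → ℕ) : ℝ :=
  ∑ v : Fin (s / m + 1), (weight (graphOf m s f) (s / m) v : ℝ)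
    / ((degSum (graphOf m s f) (s / m) : ℝ) + 1) * F (Function.update f s v)

/-- The expectation of a function of the targets of the first `s` edges. -/
noncomputable def expect (m : ℕ) : ℕ → ((ℕ → ℕ) → ℝ) → ℝ
  | 0, F => F 0
  | s + 1, F => expect m s (stepAvg m s F)

/-- The average only visits sequences whose targets are already present, so pointwise bounds may
assume `Valid`. -/
theorem expect_mono {m s : ℕ} {F F' : (ℕ → ℕ) → ℝ} (h : ∀ f, Valid m s f → F f ≤ F' f) :
    expect m s F ≤ expect m s F' := by
  induction s generalizing F F' with
  | zero => exact h _ fun i hi => absurd hi (by omega)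
  | succ s ih =>
    refine ih fun f hf => Finset.sum_le_sum fun v _ => ?_
    refine mul_le_mul_of_nonneg_left (h _ (hf.update (by omega))) (by positivity)

theorem expect_mul_left (m s : ℕ) (c : ℝ) (F : (ℕ → ℕ) → ℝ) :
    expect m s (fun f => c * F f) = c * expect m s F := by
  induction s generalizing F with
  | zero => rfl
  | succ s ih =>
    rw [expect, expect, ← ih]
    congr 1; funext f
    simp only [stepAvg, Finset.mul_sum]
    exact Finset.sum_congr rfl fun v _ => by ring

theorem expect_sum {ι : Type*} (m s : ℕ) (A : Finset ι) (F : ι → (ℕ → ℕ) → ℝ) :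
    expect m s (fun f => ∑ i ∈ A, F i f) = ∑ i ∈ A, expect m s (F i) := by
  induction s generalizing F with
  | zero => rfl
  | succ s ih =>
    simp only [expect]
    rw [← ih]
    congr 1; funext f
    simp only [stepAvg, Finset.mul_sum]
    exact Finset.sum_comm

theorem expect_add (m s : ℕ) (F F' : (ℕ → ℕ) → ℝ) :
    expect m s (fun f => F f + F' f) = expect m s F + expect m s F' := by
  have := expect_sum m s Finset.univ (fun b : Bool => if b then F else F')
  simpa using this

theorem sum_weight_real (G : Multigraph) (u : ℕ) :
    ∑ v : Fin (u + 1), (weight G u v : ℝ) / ((degSum G u : ℝ) + 1) = 1 := by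
  have h : ∑ v : Fin (u + 1), weight G u v = degSum G u + 1 := by
    have h1 : ∀ v : Fin (u + 1), ((v : ℕ) = u) ↔ v = Fin.last u := by
      intro v; rw [Fin.ext_iff, Fin.val_last]
    simp [weight, degSum, Finset.sum_add_distrib, h1]
  rw [← Finset.sum_div, ← Nat.cast_sum, h]
  push_cast
  exact div_self (by positivity)

theorem expect_const (m s : ℕ) (c : ℝ) : expect m s (fun _ => c) = c := by
  induction s with
  | zero => rfl
  | succ s ih =>
    rw [expect]
    refine Eq.trans ?_ ih
    congr 1; funext f
    rw [stepAvg, ← Finset.sum_mul, sum_weight_real, one_mul]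

/-- Averaging a function of the graph over the last edge gives again a function of the graph, so the
induction generalizes over `F`. From here on probabilities are finite real sums. -/
theorem tsum_edgeProcess (m s : ℕ) (F : Multigraph → ℝ) (hF : ∀ G, 0 ≤ F G) :
    ∑' G, edgeProcess m s G * ENNReal.ofReal (F G)
      = ENNReal.ofReal (expect m s fun f => F (graphOf m s f)) := by
  induction s generalizing F with
  | zero =>
    rw [tsum_eq_single 0]
    · simp [edgeProcess, expect, graphOf_zero]
    · intro G hG
      simp [edgeProcess, hG]
  | succ s ih =>
    have h1 : ∀ H : Multigraph,
        ∑' G, ((target H (s / m)).map fun v : Fin (s / m + 1) => s(s / m, (v : ℕ)) ::ₘ H) G * ENNReal.ofReal (F G)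
          = ENNReal.ofReal (∑ v : Fin (s / m + 1), (weight H (s / m) v : ℝ)
            / ((degSum H (s / m) : ℝ) + 1) * F (s(s / m, (v : ℕ)) ::ₘ H)) := by
      intro H
      rw [ENNReal.ofReal_sum_of_nonneg
        (fun v _ => mul_nonneg (by positivity) (hF _))]
      simp only [PMF.map_apply, ← ENNReal.tsum_mul_right]
      rw [ENNReal.tsum_comm, tsum_fintype]
      refine Finset.sum_congr rfl fun v _ => ?_
      rw [tsum_eq_single (s(s / m, (v : ℕ)) ::ₘ H)]
      · rw [if_pos rfl, ENNReal.ofReal_mul (by positivity),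
          ENNReal.ofReal_div_of_pos (by positivity), ENNReal.ofReal_add (by positivity) (by simp)]
        simp [target]
      · intro G hG
        rw [if_neg hG, zero_mul]
    rw [expect, edgeProcess]
    simp only [PMF.bind_apply, ← ENNReal.tsum_mul_right]
    rw [ENNReal.tsum_comm]
    simp only [mul_assoc, ENNReal.tsum_mul_left, h1]
    rw [ih _ fun G => Finset.sum_nonneg fun v _ => mul_nonneg (by positivity) (hF _)]
    congr 2; funext f
    simp only [stepAvg, graphOf_succ_update]

theorem toOuterMeasure_prefAttach (m n : ℕ) (hm : 1 ≤ m) (A : Set Multigraph) :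
    (prefAttach m n).toOuterMeasure A
      = ENNReal.ofReal (expect m (m * n) fun f => A.indicator 1 (graphOf m (m * n) f)) := by
  rw [prefAttach_eq_edgeProcess m n hm,
    ← tsum_edgeProcess m (m * n) (A.indicator 1) (Set.indicator_nonneg fun _ _ => zero_le_one),
    PMF.toOuterMeasure_apply]
  refine tsum_congr fun G => ?_
  by_cases hG : G ∈ A <;> simp [hG]

/-! ### The growth rate of degrees -/

/-- The factor by which the expected degree of an old node grows in the first `s` insertions. -/
noncomputable def growth : ℕ → ℝ
  | 0 => 1
  | s + 1 => growth s * (1 + 1 / (2 * s + 1))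

theorem growth_pos (s : ℕ) : 0 < growth s := by
  induction s with
  | zero => exact one_pos
  | succ s ih => rw [growth]; positivity

theorem le_growth_sq (s : ℕ) : 2 * (s : ℝ) + 1 ≤ growth s ^ 2 := by
  induction s with
  | zero => simp [growth]
  | succ s ih =>
    rw [growth, mul_pow]
    have h : (2 * (s : ℝ) + 1) * (1 + 1 / (2 * s + 1)) ^ 2 ≥ 2 * (s + 1 : ℕ) + 1 := by
      have : (2 * (s : ℝ) + 1) * (1 + 1 / (2 * s + 1)) ^ 2
          = (2 * s + 3) + 1 / (2 * s + 1) := by field_simp; ring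
      rw [this]; push_cast
      have : 0 < 1 / (2 * (s : ℝ) + 1) := by positivity
      linarith
    exact h.trans (mul_le_mul_of_nonneg_right ih (by positivity))

theorem growth_sq_le (s : ℕ) : growth s ^ 2 ≤ 4 * s + 1 := by
  induction s with
  | zero => simp [growth]
  | succ s ih =>
    rw [growth, mul_pow]
    refine (mul_le_mul_of_nonneg_right ih (by positivity)).trans ?_
    have : (4 * (s : ℝ) + 1) * (1 + 1 / (2 * s + 1)) ^ 2
        = 4 * s + 5 - 1 / (2 * s + 1) ^ 2 := by
      field_simp; ring
    rw [this]; push_cast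
    have : 0 ≤ 1 / (2 * (s : ℝ) + 1) ^ 2 := by positivity
    linarith

/-- This is why potentials use `deg + k` instead of `deg`: with the shift, `r ≤ k` demands on the
same node raise the average no more than `r` independent ones would. With `X` the power, `X * (d + k
- r) ≤ d + k` and `X ≥ 1` give the claim. -/
theorem mul_pow_sub_one_le {d : ℝ} (hd : 0 ≤ d) {k r : ℕ} (hk : 0 < k) (hr : r ≤ k) :
    d * ((1 + 1 / (d + k)) ^ r - 1) ≤ r := by
  have hD : 0 < d + k := by positivity
  have h1 : ∀ q : ℕ, q ≤ k → (1 + 1 / (d + k)) ^ q * (d + k - q) ≤ d + k := by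
    intro q hq
    induction q with
    | zero => simp
    | succ q ih =>
      refine le_trans ?_ (ih (by omega))
      rw [pow_succ, mul_assoc]
      refine mul_le_mul_of_nonneg_left ?_ (by positivity)
      have : (1 + 1 / (d + k)) * (d + k - (q + 1 : ℕ)) = d + k - q - (q + 1) / (d + k) := by
        push_cast; field_simp; ring
      rw [this]
      have : 0 ≤ ((q : ℝ) + 1) / (d + k) := by positivity
      linarith
  have h2 := h1 r hr
  have h3 : 1 ≤ (1 + 1 / (d + k)) ^ r := one_le_pow₀ (by simp; positivity)
  have h4 : (r : ℝ) ≤ k := by exact_mod_cast hr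
  nlinarith [mul_nonneg (sub_nonneg.mpr h3) (sub_nonneg.mpr h4)]

/-! ### The probability that prescribed edges are present -/

/-- The contribution to the potential, after `s` insertions, of the demand that edge number `t`
goes to `x`; here `k` is the total number of demands. -/
noncomputable def potential (m k s : ℕ) (f : ℕ → ℕ) (t x : ℕ) : ℝ :=
  if t < s then (if f t = x then 1 else 0)
  else if m * (x + 1) ≤ s then
    (deg (graphOf m s f) x + k) * (growth t / (growth s * (2 * t + 1)))
  else (2 * m + k) * (growth t / (growth (m * (x + 1)) * (2 * t + 1)))

/-- The factor by which `potential` changes if edge number `s` goes to `v`. -/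
noncomputable def gain (m k s : ℕ) (f : ℕ → ℕ) (t x v : ℕ) : ℝ :=
  if t < s then 1
  else if t = s then
    (if x = v then (2 * s + 1) / (deg (graphOf m s f) v + k) else 0)
  else if m * (x + 1) ≤ s then
    (if x = v then 1 + 1 / ((deg (graphOf m s f) v : ℝ) + k) else 1) / (1 + 1 / (2 * s + 1))
  else 1

theorem potential_nonneg (m k s : ℕ) (f : ℕ → ℕ) (t x : ℕ) : 0 ≤ potential m k s f t x := by
  have h1 := (growth_pos t).le
  have h2 := (growth_pos s).le
  have h3 := (growth_pos (m * (x + 1))).le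
  unfold potential
  split_ifs <;> positivity

theorem gain_nonneg (m k s : ℕ) (f : ℕ → ℕ) (t x v : ℕ) : 0 ≤ gain m k s f t x v := by
  unfold gain
  split_ifs <;> positivity

/-- Equality holds except at the insertion that completes the `m` edges of `x`, where the actual
degree replaces its bound `2 * m`. -/
theorem potential_succ_le {m k s : ℕ} (hm : 1 ≤ m) (hk : 0 < k) {f : ℕ → ℕ} (hf : Valid m s f)
    {t x v : ℕ} (hx : x < t / m) (hv : v ≤ s / m) :
    potential m k (s + 1) (Function.update f s v) t x
      ≤ potential m k s f t x * gain m k s f t x v := by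
  have hgt := growth_pos t
  have hgs := growth_pos s
  have hxt : m * (x + 1) ≤ t :=
    (Nat.mul_le_mul_left m hx).trans (Nat.mul_div_le t m)
  have hdeg : deg (graphOf m (s + 1) (Function.update f s v)) x
      = deg (graphOf m s f) x + (if s / m = x then 1 else 0) + (if v = x then 1 else 0) := by
    rw [graphOf_succ_update, deg_cons]
  unfold potential gain
  rcases lt_trichotomy t s with h | h | h
  · rw [if_pos (by omega), if_pos h, if_pos h, Function.update_of_ne h.ne, mul_one]
  · subst h
    rw [if_pos (by omega), if_neg (lt_irrefl t), if_neg (lt_irrefl t), if_pos rfl, if_pos hxt,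
      Function.update_self]
    by_cases hvx : v = x
    · subst hvx
      rw [if_pos rfl, if_pos rfl]
      have : (0 : ℝ) < deg (graphOf m t f) v + k := by positivity
      refine le_of_eq ?_
      field_simp
    · rw [if_neg hvx, if_neg (Ne.symm hvx), mul_zero]
  · rw [if_neg (show ¬ t < s + 1 by omega), if_neg h.not_gt, if_neg h.not_gt, if_neg h.ne']
    rcases lt_trichotomy (m * (x + 1)) (s + 1) with hb | hb | hb
    · have hb' : m * (x + 1) ≤ s := by omega
      have hne : s / m ≠ x := by
        have := (Nat.le_div_iff_mul_le (k := m) (x := x + 1) (y := s) hm).mpr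
          (by rw [mul_comm]; exact hb')
        omega
      rw [if_pos hb.le, if_pos hb', if_pos hb', hdeg, if_neg hne, growth]
      have h0 : (0 : ℝ) < deg (graphOf m s f) x + k := by positivity
      refine le_of_eq ?_
      by_cases hvx : v = x
      · subst hvx
        rw [if_pos rfl, if_pos rfl]
        push_cast
        field_simp
        ring
      · rw [if_neg hvx, if_neg (Ne.symm hvx)]
        push_cast
        field_simp
        ring
    · rw [if_pos hb.le, if_neg (by omega), if_neg (by omega), mul_one, hb]
      have h1 := deg_graphOf_le (hf.update hv) (x := x) hm
      have h2 : deg (graphOf m (s + 1) (Function.update f s v)) x ≤ 2 * m := by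
        have : m * (x + 1) = m * x + m := by ring
        omega
      have h3 : (deg (graphOf m (s + 1) (Function.update f s v)) x : ℝ) ≤ 2 * m := by
        exact_mod_cast h2
      have := growth_pos (s + 1)
      gcongr
    · rw [if_neg (by omega), if_neg (by omega), if_neg (by omega), mul_one]

/-- The probability that edge number `s` goes to the node `v`. -/
theorem weight_div_degSum {m s : ℕ} {f : ℕ → ℕ} (hf : Valid m s f) (v : ℕ) :
    (weight (graphOf m s f) (s / m) v : ℝ) / ((degSum (graphOf m s f) (s / m) : ℝ) + 1)
      = (deg (graphOf m s f) v + if v = s / m then 1 else 0) / (2 * s + 1) := by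
  rw [degSum_graphOf hf, weight]
  push_cast
  rfl

theorem gain_le {m k s : ℕ} (f : ℕ → ℕ) {t x v : ℕ} (ht : t ≠ s) :
    gain m k s f t x v ≤ 1 + 1 / ((deg (graphOf m s f) v : ℝ) + k) := by
  have h0 : (0 : ℝ) ≤ 1 / ((deg (graphOf m s f) v : ℝ) + k) := by positivity
  unfold gain
  rw [if_neg ht]
  split_ifs
  · linarith
  · exact div_le_self (by positivity) (by simp; positivity)
  · exact (div_le_self (by positivity) (by simp; positivity)).trans (by linarith)
  · linarith

/-- The supermartingale inequality. If some demand concerns edge `s`, only its target contributes;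
otherwise the normalization by `growth` compensates the gain of all pending demands. Both cases rest
on `mul_pow_sub_one_le`. -/
theorem stepAvg_gain_le {ι : Type*} [Fintype ι] {m s : ℕ} (hm : 1 ≤ m) {f : ℕ → ℕ}
    (hf : Valid m s f) {t x : ι → ℕ} (ht : Function.Injective t) (hx : ∀ i, x i < t i / m) :
    ∑ v : Fin (s / m + 1), (weight (graphOf m s f) (s / m) v : ℝ)
      / ((degSum (graphOf m s f) (s / m) : ℝ) + 1)
      * ∏ i, gain m (Fintype.card ι) s f (t i) (x i) v ≤ 1 := by
  classical
  set k := Fintype.card ι with hk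
  by_cases hex : ∃ i₀, t i₀ = s
  · obtain ⟨i₀, hi₀⟩ := hex
    have hk0 : 0 < k := Fintype.card_pos_iff.mpr ⟨i₀⟩
    have hx0 : x i₀ < s / m := hi₀ ▸ hx i₀
    rw [Finset.sum_eq_single (⟨x i₀, by omega⟩ : Fin (s / m + 1))]
    · rw [weight_div_degSum hf, ← Finset.mul_prod_erase _ _ (Finset.mem_univ i₀)]
      simp only
      set d : ℝ := (deg (graphOf m s f) (x i₀) : ℝ) with hd
      have hd0 : 0 ≤ d := Nat.cast_nonneg _
      have hdk : 0 < d + k := by positivity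
      have h1 : gain m k s f (t i₀) (x i₀) (x i₀) = (2 * s + 1) / (d + k) := by
        simp [gain, hi₀, hd]
      have h2 : ∏ i ∈ Finset.univ.erase i₀, gain m k s f (t i) (x i) (x i₀)
          ≤ (1 + 1 / (d + k)) ^ (k - 1) := by
        have hc : (Finset.univ.erase i₀).card = k - 1 := by
          rw [Finset.card_erase_of_mem (Finset.mem_univ _), Finset.card_univ]
        rw [← hc, ← Finset.prod_const]
        refine Finset.prod_le_prod (fun i _ => gain_nonneg ..) fun i hi => gain_le f ?_
        rw [← hi₀]
        exact fun h => Finset.ne_of_mem_erase hi (ht h)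
      rw [h1, if_neg hx0.ne, add_zero]
      have h3 := mul_pow_sub_one_le hd0 hk0 (Nat.sub_le k 1)
      have h4 : d / (2 * s + 1) * ((2 * s + 1) / (d + k)) = d / (d + k) := by
        field_simp
      rw [← mul_assoc, h4]
      refine (mul_le_mul_of_nonneg_left h2 (by positivity)).trans ?_
      rw [div_mul_eq_mul_div, div_le_one hdk]
      have h5 : ((k - 1 : ℕ) : ℝ) ≤ k := by exact_mod_cast Nat.sub_le k 1
      linarith
    · intro v _ hv
      rw [Finset.prod_eq_zero (Finset.mem_univ i₀), mul_zero]
      have : x i₀ ≠ v := fun h => hv (Fin.ext h.symm)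
      simp [gain, hi₀, this]
    · simp
  · push Not at hex
    -- `B` holds the pending demands whose target already has its own `m` edges; all others have
    -- gain 1.
    set B := Finset.univ.filter fun i => s < t i ∧ m * (x i + 1) ≤ s with hB
    set ρ : ℝ := 1 + 1 / (2 * s + 1) with hρ
    have hρ0 : 0 < ρ := by positivity
    set r : ℕ → ℕ := fun v => (B.filter fun i => x i = v).card with hr
    have hxB : ∀ i ∈ B, x i < s / m := by
      intro i hi
      have := (Finset.mem_filter.mp hi).2.2
      exact (Nat.le_div_iff_mul_le (k := m) (x := x i + 1) (y := s) hm).mpr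
        (by rw [mul_comm]; exact this)
    have hprod : ∀ v : ℕ, ∏ i, gain m k s f (t i) (x i) v
        = (1 + 1 / ((deg (graphOf m s f) v : ℝ) + k)) ^ r v / ρ ^ B.card := by
      intro v
      rw [← Finset.prod_const, ← Finset.prod_const, Finset.prod_filter, ← Finset.prod_div_distrib,
        hB, Finset.prod_filter]
      refine Finset.prod_congr rfl fun i _ => ?_
      have h1 := hex i
      unfold gain
      split_ifs <;> first | rfl | omega
    have hterm : ∀ v : Fin (s / m + 1), (weight (graphOf m s f) (s / m) v : ℝ)
        / ((degSum (graphOf m s f) (s / m) : ℝ) + 1)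
        * (1 + 1 / ((deg (graphOf m s f) v : ℝ) + k)) ^ r v
        ≤ (weight (graphOf m s f) (s / m) v : ℝ)
          / ((degSum (graphOf m s f) (s / m) : ℝ) + 1) + r v / (2 * s + 1) := by
      intro v
      rcases Nat.eq_zero_or_pos (r v) with h0 | h0
      · rw [h0]; simp
      · obtain ⟨i, hi⟩ := Finset.card_pos.mp h0
        rw [Finset.mem_filter] at hi
        have hv : (v : ℕ) ≠ s / m := by
          have := hxB i hi.1
          omega
        have hk0 : 0 < k := Fintype.card_pos_iff.mpr ⟨i⟩
        have hrk : r v ≤ k :=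
          (Finset.card_filter_le _ _).trans (Finset.card_le_univ _)
        have h3 := mul_pow_sub_one_le (d := (deg (graphOf m s f) v : ℝ)) (Nat.cast_nonneg _)
          hk0 hrk
        rw [weight_div_degSum hf, if_neg hv, add_zero, div_mul_eq_mul_div, ← add_div]
        gcongr
        linarith
    have hsum : ∑ v : Fin (s / m + 1), (r v : ℝ) = B.card := by
      rw [← Nat.cast_sum]
      congr 1
      simp only [hr, Finset.card_filter]
      rw [Finset.sum_comm, Finset.card_eq_sum_ones]
      exact Finset.sum_congr rfl fun i hi => sum_fin_ite_eq (hxB i hi).le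
    simp only [hprod, ← mul_div_assoc]
    rw [← Finset.sum_div, div_le_one (by positivity)]
    refine (Finset.sum_le_sum fun v _ => hterm v).trans ?_
    rw [Finset.sum_add_distrib, sum_weight_real, ← Finset.sum_div, hsum]
    -- The numerators average to at most `1 + |B| / (2s + 1)`, which Bernoulli's inequality bounds
    -- by `ρ ^ |B|`.
    have := one_add_mul_le_pow (a := 1 / (2 * (s : ℝ) + 1)) (by
      have : (0 : ℝ) ≤ 1 / (2 * s + 1) := by positivity
      linarith) B.card
    rw [hρ]
    refine le_trans (le_of_eq ?_) this
    ring

theorem expect_prod_potential_le {ι : Type*} [Fintype ι] {m : ℕ} (hm : 1 ≤ m)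
    {t x : ι → ℕ} (ht : Function.Injective t) (hx : ∀ i, x i < t i / m) (s : ℕ) :
    expect m s (fun f => ∏ i, potential m (Fintype.card ι) s f (t i) (x i))
      ≤ ∏ i, potential m (Fintype.card ι) 0 0 (t i) (x i) := by
  induction s with
  | zero => exact le_rfl
  | succ s ih =>
    rw [expect]
    refine le_trans (expect_mono fun f hf => ?_) ih
    have hP : 0 ≤ ∏ i, potential m (Fintype.card ι) s f (t i) (x i) :=
      Finset.prod_nonneg fun i _ => potential_nonneg ..
    refine le_trans ?_ (mul_le_of_le_one_right hP (stepAvg_gain_le hm hf ht hx))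
    rw [stepAvg, Finset.mul_sum]
    refine Finset.sum_le_sum fun v _ => ?_
    rw [mul_left_comm]
    refine mul_le_mul_of_nonneg_left ?_ (by positivity)
    rw [← Finset.prod_mul_distrib]
    refine Finset.prod_le_prod (fun i _ => potential_nonneg ..) fun i _ => ?_
    exact potential_succ_le hm (Fintype.card_pos_iff.mpr ⟨i⟩) hf (hx i) (by omega)

/-- A bound for the probability that the edges `t i` go to the nodes `x i`. -/
theorem expect_prod_indicator_le {ι : Type*} [Fintype ι] {m : ℕ} (hm : 1 ≤ m)
    {t x : ι → ℕ} (hinj : ∀ i j, t i = t j → x i = x j → i = j) (hx : ∀ i, x i < t i / m)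
    {s : ℕ} (hs : ∀ i, t i < s) :
    expect m s (fun f => ∏ i, if f (t i) = x i then (1 : ℝ) else 0)
      ≤ ∏ i, ((2 * m + Fintype.card ι) * (2 / (√((t i / m : ℕ) + 1) * √(x i + 1)))) := by
  have hR : ∀ i, 0 ≤ (2 * m + Fintype.card ι) * (2 / (√((t i / m : ℕ) + 1) * √(x i + 1))) :=
    fun i => by positivity
  by_cases ht : Function.Injective t
  · have h1 : ∀ f, ∏ i, (if f (t i) = x i then (1 : ℝ) else 0)
        = ∏ i, potential m (Fintype.card ι) s f (t i) (x i) := fun f =>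
      Finset.prod_congr rfl fun i _ => by rw [potential, if_pos (hs i)]
    simp only [h1]
    refine (expect_prod_potential_le hm ht hx s).trans ?_
    refine Finset.prod_le_prod (fun i _ => potential_nonneg ..) fun i _ => ?_
    have hb : ¬ m * (x i + 1) ≤ 0 := by
      have := Nat.mul_pos hm (Nat.succ_pos (x i))
      exact this.not_ge
    rw [potential, if_neg (by omega), if_neg hb]
    refine mul_le_mul_of_nonneg_left ?_ (by positivity)
    have g1 := growth_pos (t i)
    have g2 := growth_pos (m * (x i + 1))
    have h2 : √((t i / m : ℕ) + 1) ≤ growth (t i) := by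
      refine (Real.sqrt_le_sqrt ?_).trans ((Real.sqrt_le_sqrt (le_growth_sq (t i))).trans
        (Real.sqrt_sq g1.le).le)
      have : ((t i / m : ℕ) : ℝ) ≤ t i := by exact_mod_cast Nat.div_le_self _ _
      have h0 : (0 : ℝ) ≤ t i := Nat.cast_nonneg _
      linarith
    have h3 : √(x i + 1 : ℝ) ≤ growth (m * (x i + 1)) := by
      refine (Real.sqrt_le_sqrt ?_).trans ((Real.sqrt_le_sqrt (le_growth_sq _)).trans
        (Real.sqrt_sq g2.le).le)
      have : ((x i : ℝ) + 1) ≤ (m * (x i + 1) : ℕ) := by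
        exact_mod_cast Nat.le_mul_of_pos_left (x i + 1) hm
      have h0 : (0 : ℝ) ≤ (m * (x i + 1) : ℕ) := Nat.cast_nonneg _
      linarith
    -- The constant 2 arises from `growth t ^ 2 ≤ 4t + 1 ≤ 2 (2t + 1)`.
    have h4 := growth_sq_le (t i)
    calc growth (t i) / (growth (m * (x i + 1)) * (2 * (t i) + 1))
        ≤ 2 / (growth (t i) * growth (m * (x i + 1))) := by
          rw [div_le_div_iff₀ (by positivity) (by positivity)]
          nlinarith
      _ ≤ _ := by gcongr
  -- Here one edge is required to have two different targets, which is impossible.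
  · have hz : ∀ f : ℕ → ℕ, ∏ i, (if f (t i) = x i then (1 : ℝ) else 0) = 0 := by
      intro f
      rw [Function.Injective] at ht
      push Not at ht
      obtain ⟨i, j, hij, hne⟩ := ht
      rw [Finset.prod_eq_zero_iff]
      by_contra hcon
      push Not at hcon
      have hi := hcon i (Finset.mem_univ i)
      have hj := hcon j (Finset.mem_univ j)
      have hi' : f (t i) = x i := by by_contra h; simp [h] at hi
      have hj' : f (t j) = x j := by by_contra h; simp [h] at hj
      exact hne (hinj i j hij (by rw [← hi', ← hj', hij]))
    simp only [hz, expect_const]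
    exact Finset.prod_nonneg fun i _ => hR i

/-! ### Old nodes have large degree -/

/-- With `y = 1 / (2s + 1)` the average is exactly `1/d - y/(d + 1)`. As `d ≥ 1`, this is at most
`(1 - y/2)/d`, and `1 - y/2 ≤ (1 + y)^(-1/2)`. Using `d + 1 ≤ 2d` is what costs the square root. -/
theorem stepAvg_inv_deg_le {m s x : ℕ} (hm : 1 ≤ m) (hx : m * (x + 1) ≤ s) {f : ℕ → ℕ}
    (hf : Valid m s f) :
    stepAvg m s (fun f => 1 / (deg (graphOf m (s + 1) f) x : ℝ)) f
      ≤ √(growth s / growth (s + 1)) * (1 / (deg (graphOf m s f) x : ℝ)) := by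
  have hxs : x < s / m :=
    (Nat.le_div_iff_mul_le (k := m) (x := x + 1) (y := s) hm).mpr (by rw [mul_comm]; exact hx)
  have hd1 : 1 ≤ deg (graphOf m s f) x := one_le_deg_graphOf f hm (by
    have : m * (x + 1) = m * x + m := by ring
    omega)
  set d : ℝ := (deg (graphOf m s f) x : ℝ) with hd
  have hd1' : 1 ≤ d := by rw [hd]; exact_mod_cast hd1
  have hd0 : 0 < d := by linarith
  set y : ℝ := 1 / (2 * s + 1) with hy
  have hy0 : 0 < y := by positivity
  have hy1 : y ≤ 1 := by
    rw [hy, div_le_one (by positivity)]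
    have : (0 : ℝ) ≤ s := Nat.cast_nonneg s
    linarith
  have hstep : stepAvg m s (fun f => 1 / (deg (graphOf m (s + 1) f) x : ℝ)) f
      = 1 / d - y / (d + 1) := by
    have h1 : ∀ v : Fin (s / m + 1),
        1 / (deg (graphOf m (s + 1) (Function.update f s v)) x : ℝ)
          = 1 / d - if (v : ℕ) = x then 1 / d - 1 / (d + 1) else 0 := by
      intro v
      rw [graphOf_succ_update, deg_cons, if_neg hxs.ne']
      by_cases hv : (v : ℕ) = x
      · rw [if_pos hv, if_pos hv, hd]; push_cast; ring
      · rw [if_neg hv, if_neg hv, hd]; push_cast; ring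
    simp only [stepAvg, h1, mul_sub]
    rw [Finset.sum_sub_distrib, ← Finset.sum_mul, sum_weight_real, one_mul]
    congr 1
    rw [Finset.sum_eq_single (⟨x, by omega⟩ : Fin (s / m + 1))]
    · rw [weight_div_degSum hf, if_neg hxs.ne, if_pos rfl, add_zero, hy]
      simp only [← hd]
      field_simp
      ring
    · intro v _ hv
      rw [if_neg fun h => hv (Fin.ext h), mul_zero]
    · simp
  have hroot : 1 - y / 2 ≤ √(growth s / growth (s + 1)) := by
    refine Real.le_sqrt_of_sq_le ?_
    have hg := growth_pos s
    have : growth s / growth (s + 1) = 1 / (1 + y) := by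
      rw [growth, ← hy]; field_simp
    rw [this, le_div_iff₀ (by positivity)]
    nlinarith [mul_nonneg (sq_nonneg y) (sub_nonneg.mpr hy1)]
  rw [hstep]
  refine le_trans ?_ (mul_le_mul_of_nonneg_right hroot (by positivity))
  have : y / (2 * d) ≤ y / (d + 1) := by gcongr; linarith
  have h2 : (1 - y / 2) * (1 / d) = 1 / d - y / (2 * d) := by field_simp
  linarith

theorem expect_inv_deg_le {m x N : ℕ} (hm : 1 ≤ m) (hN : m * (x + 1) ≤ N) :
    expect m N (fun f => 1 / (deg (graphOf m N f) x : ℝ))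
      ≤ √(growth (m * (x + 1)) / growth N) := by
  induction N, hN using Nat.le_induction with
  | base =>
    rw [div_self (growth_pos _).ne', Real.sqrt_one]
    refine (expect_mono fun f _ => ?_).trans (expect_const m _ 1).le
    have h1 : 1 ≤ deg (graphOf m (m * (x + 1)) f) x := one_le_deg_graphOf f hm (by
      have : m * (x + 1) = m * x + m := by ring
      omega)
    exact (div_le_one (by positivity)).mpr (by exact_mod_cast h1)
  | succ s hs ih =>
    rw [expect]
    refine (expect_mono fun f hf => stepAvg_inv_deg_le hm hs hf).trans ?_
    rw [expect_mul_left]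
    refine (mul_le_mul_of_nonneg_left ih (Real.sqrt_nonneg _)).trans ?_
    have h1 := growth_pos s
    have h2 := growth_pos (s + 1)
    rw [← Real.sqrt_mul (by positivity)]
    refine le_of_eq ?_
    congr 1
    field_simp

/-! ### Common neighbours of young nodes -/

/-- The number of edges between two distinct nodes `a` and `b`. -/
noncomputable def edgeCount (m : ℕ) (f : ℕ → ℕ) (a b : ℕ) : ℝ :=
  ∑ j ∈ Finset.range m, if f (m * max a b + j) = min a b then (1 : ℝ) else 0

theorem edgeCount_nonneg (m : ℕ) (f : ℕ → ℕ) (a b : ℕ) : 0 ≤ edgeCount m f a b :=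
  Finset.sum_nonneg fun _ _ => by split_ifs <;> norm_num

/-- Every edge is inserted by its younger endpoint. -/
theorem mem_graphOf {m s : ℕ} {f : ℕ → ℕ} (hf : Valid m s f) {a b : ℕ}
    (h : s(a, b) ∈ graphOf m s f) : ∃ i < s, i / m = max a b ∧ f i = min a b := by
  rw [graphOf, Multiset.mem_map] at h
  obtain ⟨i, hi, he⟩ := h
  rw [Multiset.mem_range] at hi
  have := hf i hi
  rw [Sym2.eq_iff] at he
  refine ⟨i, hi, ?_⟩
  rcases he with ⟨h1, h2⟩ | ⟨h1, h2⟩ <;> constructor <;> omega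

theorem lt_of_mem_graphOf {m n : ℕ} {f : ℕ → ℕ} (hf : Valid m (m * n) f) {a b : ℕ}
    (h : s(a, b) ∈ graphOf m (m * n) f) : a < n ∧ b < n := by
  obtain ⟨i, hi, h1, -⟩ := mem_graphOf hf h
  have : i / m < n := Nat.div_lt_of_lt_mul hi
  omega

theorem one_le_edgeCount {m s : ℕ} (hm : 1 ≤ m) {f : ℕ → ℕ} (hf : Valid m s f) {a b : ℕ}
    (h : s(a, b) ∈ graphOf m s f) : 1 ≤ edgeCount m f a b := by
  obtain ⟨i, -, h1, h2⟩ := mem_graphOf hf h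
  have h3 : m * max a b + i % m = i := by rw [← h1]; exact Nat.div_add_mod i m
  have := Finset.single_le_sum (s := Finset.range m)
    (f := fun j => if f (m * max a b + j) = min a b then (1 : ℝ) else 0)
    (fun _ _ => by split_ifs <;> norm_num) (Finset.mem_range.mpr (Nat.mod_lt i hm))
  rwa [h3, if_pos h2] at this

/-- The number of ways in which the four nodes `w i` are joined to both `u` and `v`. -/
noncomputable def joinCount (m : ℕ) (f : ℕ → ℕ) (u v : ℕ) (w : Fin 4 → ℕ) : ℝ :=
  ∏ i : Fin 4 × Bool, edgeCount m f (cond i.2 u v) (w i.1)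

theorem joinCount_nonneg (m : ℕ) (f : ℕ → ℕ) (u v : ℕ) (w : Fin 4 → ℕ) :
    0 ≤ joinCount m f u v w := Finset.prod_nonneg fun _ _ => edgeCount_nonneg ..

/-- Expanding the product leaves `m ^ 8` choices of edge slots, each a set of eight demands. Each `w
i` lies on two of the edges and `u`, `v` on four each, whence the exponents 1 and 2. -/
theorem expect_joinCount_le {m n u v : ℕ} (hm : 1 ≤ m) (hu : u < n) (hv : v < n) (huv : u ≠ v)
    {w : Fin 4 → ℕ} (hw : ∀ i, w i < n) (hinj : Function.Injective w) (hwu : ∀ i, w i ≠ u)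
    (hwv : ∀ i, w i ≠ v) :
    expect m (m * n) (fun f => joinCount m f u v w)
      ≤ (m * (2 * (2 * m + 8))) ^ 8 *
        ((1 / ((u : ℝ) + 1) ^ 2) * (1 / ((v : ℝ) + 1) ^ 2) * ∏ i, 1 / ((w i : ℝ) + 1)) := by
  set e : Fin 4 × Bool → ℕ := fun i => cond i.2 u v with he
  have hen : ∀ i, e i < n := by rintro ⟨i, _ | _⟩ <;> simpa [he]
  have hew : ∀ i j, e i ≠ w j := by
    rintro ⟨i, _ | _⟩ j
    · exact (hwv j).symm
    · exact (hwu j).symm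
  have hexp : ∀ f, joinCount m f u v w
      = ∑ p ∈ Fintype.piFinset fun _ : Fin 4 × Bool => Finset.range m,
        ∏ i, if f (m * max (e i) (w i.1) + p i) = min (e i) (w i.1) then (1 : ℝ) else 0 := by
    intro f
    exact Finset.prod_univ_sum (fun _ => Finset.range m)
      (fun i j => if f (m * max (e i) (w i.1) + j) = min (e i) (w i.1) then (1 : ℝ) else 0)
  have hterm : ∀ p ∈ Fintype.piFinset fun _ : Fin 4 × Bool => Finset.range m,
      expect m (m * n) (fun f => ∏ i, if f (m * max (e i) (w i.1) + p i) = min (e i) (w i.1)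
        then (1 : ℝ) else 0)
      ≤ ∏ i : Fin 4 × Bool, ((2 * (2 * m + 8)) * (1 / (√(w i.1 + 1) * √(e i + 1)))) := by
    intro p hp
    rw [Fintype.mem_piFinset] at hp
    have hp' : ∀ i, p i < m := fun i => Finset.mem_range.mp (hp i)
    have hdiv : ∀ i, (m * max (e i) (w i.1) + p i) / m = max (e i) (w i.1) := fun i => by
      rw [Nat.mul_add_div hm, Nat.div_eq_of_lt (hp' i), add_zero]
    refine (expect_prod_indicator_le hm (t := fun i => m * max (e i) (w i.1) + p i)
      (x := fun i => min (e i) (w i.1)) ?_ ?_ ?_).trans (le_of_eq ?_)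
    -- Equal maxima and minima mean equal unordered pairs; since no `w` equals `u` or `v`, the pairs
    -- agree entrywise.
    · intro i j h1 h2
      have h3 : max (e i) (w i.1) = max (e j) (w j.1) := by
        rw [← hdiv i, ← hdiv j]; exact congrArg (· / m) h1
      have h4 := hew i i.1
      have h5 := hew i j.1
      have h6 := hew j i.1
      have h7 : e i = e j ∧ w i.1 = w j.1 := by omega
      refine Prod.ext (hinj h7.2) ?_
      have h8 := h7.1
      rcases i with ⟨i, _ | _⟩ <;> rcases j with ⟨j, _ | _⟩ <;> simp_all
    · intro i
      simp only [hdiv]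
      have := hew i i.1
      omega
    · intro i
      have h1 : max (e i) (w i.1) + 1 ≤ n := by
        have := hen i
        have := hw i.1
        omega
      have h2 := Nat.mul_le_mul_left m h1
      have h3 := hp' i
      have h4 : m * (max (e i) (w i.1) + 1) = m * max (e i) (w i.1) + m := by ring
      omega
    · refine Finset.prod_congr rfl fun i _ => ?_
      have hc : (Fintype.card (Fin 4 × Bool) : ℝ) = 8 := by simp
      rw [hdiv, hc]
      rcases le_total (e i) (w i.1) with h | h
      · rw [max_eq_right h, min_eq_left h]; ring
      · rw [max_eq_left h, min_eq_right h]; ring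
  simp only [hexp]
  rw [expect_sum]
  refine (Finset.sum_le_card_nsmul _ _ _ hterm).trans (le_of_eq ?_)
  rw [nsmul_eq_mul, Fintype.card_piFinset, Finset.prod_mul_distrib, Fintype.prod_prod_type
    (f := fun i : Fin 4 × Bool => 1 / (√((w i.1 : ℝ) + 1) * √((e i : ℝ) + 1)))]
  have hpair : ∀ i : Fin 4, ∏ b : Bool, 1 / (√((w i : ℝ) + 1) * √((e (i, b) : ℝ) + 1))
      = (1 / (√((u : ℝ) + 1) * √((v : ℝ) + 1))) * (1 / ((w i : ℝ) + 1)) := by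
    intro i
    rw [Fintype.prod_bool]
    simp only [he, cond_true, cond_false]
    have h1 : √((w i : ℝ) + 1) * √((w i : ℝ) + 1) = (w i : ℝ) + 1 :=
      Real.mul_self_sqrt (by positivity)
    have h2 : 1 / ((w i : ℝ) + 1) = 1 / (√((w i : ℝ) + 1) * √((w i : ℝ) + 1)) := by rw [h1]
    rw [h2]
    generalize √((w i : ℝ) + 1) = a
    generalize √((u : ℝ) + 1) = b
    generalize √((v : ℝ) + 1) = c
    simp only [one_div, mul_inv]
    ring
  simp only [hpair]
  have h4 : ∀ a : ℕ, √((a : ℝ) + 1) ^ 4 = ((a : ℝ) + 1) ^ 2 := by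
    intro a
    rw [show 4 = 2 * 2 from rfl, pow_mul, Real.sq_sqrt (by positivity)]
  simp only [Finset.prod_mul_distrib, Finset.prod_const, Finset.card_univ, Finset.card_range, Fintype.card_prod,
    Fintype.card_fin, Fintype.card_bool]
  rw [div_pow, one_pow, mul_pow √((u : ℝ) + 1), h4, h4, ← one_div_mul_one_div, mul_pow (m : ℝ),
    mul_assoc]
  push_cast
  rw [mul_pow 2 (2 * (m : ℝ) + 8), mul_assoc, mul_assoc, mul_assoc]

/-- The pairs of distinct nodes in `[N, n)`, with four further nodes. -/
def configurations (N n : ℕ) : Finset ((ℕ × ℕ) × (Fin 4 → ℕ)) :=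
  ((Finset.Ico N n ×ˢ Finset.Ico N n) ×ˢ Fintype.piFinset fun _ => Finset.range n).filter
    fun c => c.1.1 ≠ c.1.2 ∧ Function.Injective c.2 ∧ (∀ i, c.2 i ≠ c.1.1) ∧ ∀ i, c.2 i ≠ c.1.2

theorem sum_inv_sq_le {N n : ℕ} (hN : 1 ≤ N) :
    ∑ u ∈ Finset.Ico N n, 1 / ((u : ℝ) + 1) ^ 2 ≤ 1 / (N : ℝ) := by
  rcases le_or_gt n N with h | h
  · rw [Finset.Ico_eq_empty_of_le h, Finset.sum_empty]; positivity
  · have h1 : ∑ u ∈ Finset.Ico N n, 1 / ((u : ℝ) + 1) ^ 2 ≤ 1 / (N : ℝ) - 1 / (n : ℝ) := by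
      induction n, h.le using Nat.le_induction with
      | base => simp
      | succ n hn ih =>
        rcases hn.eq_or_lt with rfl | hlt
        · rw [Nat.Ico_succ_singleton, Finset.sum_singleton]
          have : (0 : ℝ) < N := by exact_mod_cast hN
          push_cast
          rw [div_sub_div _ _ (by positivity) (by positivity),
            div_le_div_iff₀ (by positivity) (by positivity)]
          nlinarith
        · rw [Finset.sum_Ico_succ_top hn]
          have h2 := ih hlt
          have hn0 : (0 : ℝ) < n := by
            have : 0 < n := by omega
            exact_mod_cast this
          have : 1 / ((n : ℝ) + 1) ^ 2 ≤ 1 / n - 1 / (n + 1) := by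
            rw [div_sub_div _ _ (by positivity) (by positivity),
              div_le_div_iff₀ (by positivity) (by positivity)]
            nlinarith
          push_cast
          linarith
    have : (0 : ℝ) ≤ 1 / n := by positivity
    linarith

theorem sum_inv_le (n : ℕ) : ∑ w ∈ Finset.range n, 1 / ((w : ℝ) + 1) ≤ 1 + Real.log n := by
  refine le_trans (le_of_eq ?_) (harmonic_le_one_add_log n)
  rw [harmonic]
  push_cast
  simp only [one_div]

theorem expect_sum_joinCount_le {m N n : ℕ} (hm : 1 ≤ m) (hN : 1 ≤ N) :
    expect m (m * n) (fun f => ∑ c ∈ configurations N n, joinCount m f c.1.1 c.1.2 c.2)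
      ≤ (m * (2 * (2 * m + 8))) ^ 8 * ((1 / (N : ℝ)) ^ 2 * (1 + Real.log n) ^ 4) := by
  rw [expect_sum]
  calc _ ≤ ∑ c ∈ configurations N n, (m * (2 * (2 * m + 8)) : ℝ) ^ 8 *
        ((1 / ((c.1.1 : ℝ) + 1) ^ 2) * (1 / ((c.1.2 : ℝ) + 1) ^ 2)
          * ∏ i, 1 / ((c.2 i : ℝ) + 1)) := by
        refine Finset.sum_le_sum fun c hc => ?_
        rw [configurations, Finset.mem_filter, Finset.mem_product, Finset.mem_product,
          Finset.mem_Ico, Finset.mem_Ico, Fintype.mem_piFinset] at hc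
        exact expect_joinCount_le hm hc.1.1.1.2 hc.1.1.2.2 hc.2.1
          (fun i => Finset.mem_range.mp (hc.1.2 i)) hc.2.2.1 hc.2.2.2.1 hc.2.2.2.2
    _ ≤ ∑ c ∈ (Finset.Ico N n ×ˢ Finset.Ico N n)
          ×ˢ Fintype.piFinset fun _ : Fin 4 => Finset.range n, (m * (2 * (2 * m + 8)) : ℝ) ^ 8 *
        ((1 / ((c.1.1 : ℝ) + 1) ^ 2) * (1 / ((c.1.2 : ℝ) + 1) ^ 2)
          * ∏ i, 1 / ((c.2 i : ℝ) + 1)) := by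
        refine Finset.sum_le_sum_of_subset_of_nonneg (Finset.filter_subset _ _) fun c _ _ => ?_
        have : 0 ≤ ∏ i, 1 / ((c.2 i : ℝ) + 1) := Finset.prod_nonneg fun i _ => by positivity
        positivity
    _ = (m * (2 * (2 * m + 8))) ^ 8 * ((∑ u ∈ Finset.Ico N n, 1 / ((u : ℝ) + 1) ^ 2) ^ 2
          * (∑ w ∈ Finset.range n, 1 / ((w : ℝ) + 1)) ^ 4) := by
        rw [← Finset.mul_sum, Finset.sum_product, sq (Finset.sum _ _), Finset.sum_mul_sum,
          Finset.sum_product]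
        have h4 : (∑ w ∈ Finset.range n, 1 / ((w : ℝ) + 1)) ^ 4
            = ∑ w ∈ Fintype.piFinset fun _ : Fin 4 => Finset.range n,
              ∏ i, 1 / ((w i : ℝ) + 1) := by
          rw [← Finset.prod_univ_sum (fun _ : Fin 4 => Finset.range n)
            (fun _ w => 1 / ((w : ℝ) + 1))]
          simp
        rw [h4]
        simp only [← Finset.mul_sum, ← Finset.sum_mul]
    _ ≤ _ := by
        have h1 : (0 : ℝ) ≤ ∑ u ∈ Finset.Ico N n, 1 / ((u : ℝ) + 1) ^ 2 :=
          Finset.sum_nonneg fun _ _ => by positivity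
        have h2 : (0 : ℝ) ≤ ∑ w ∈ Finset.range n, 1 / ((w : ℝ) + 1) :=
          Finset.sum_nonneg fun _ _ => by positivity
        gcongr
        · exact sum_inv_sq_le hN
        · exact sum_inv_le n

/-! ### Deterministic consequences of few common neighbours -/

theorem nbr_mono {G G' : Multigraph} (h : G' ≤ G) (u : ℕ) : nbr G' u ⊆ nbr G u :=
  fun _ hw => Multiset.mem_of_le h hw

/-- A witness that is a correct link has the form `(a, a)` with `a` a common neighbour. -/
theorem score_le_ncard {G G₁ G₂ : Multigraph} (h₁ : G₁ ≤ G) (h₂ : G₂ ≤ G) {L : Links}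
    (hL : AllCorrect L) (u v : ℕ) : score G₁ G₂ L u v ≤ (nbr G u ∩ nbr G v).ncard := by
  refine Set.ncard_le_ncard_of_injOn Prod.fst ?_ ?_ ((nbr_finite G u).inter_of_left _)
  · rintro ⟨a, b⟩ ⟨ha, hb, hab⟩
    obtain rfl : a = b := hL _ hab
    exact ⟨nbr_mono h₁ u ha, nbr_mono h₂ v hb⟩
  · rintro ⟨a, b⟩ ⟨-, -, hab⟩ ⟨c, d⟩ ⟨-, -, hcd⟩ h
    have h1 : a = b := hL _ hab
    have h2 : c = d := hL _ hcd
    have h3 : a = c := h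
    rw [← h1, ← h2, h3]

theorem scoreBelowThreshold_of_fewCommonNeighbours {n : ℕ} {G : Multigraph}
    (hG : ∀ a b : ℕ, s(a, b) ∈ G → a < n) (h : FewCommonNeighbours n G) :
    ScoreBelowThreshold n G := by
  intro G₁ G₂ h₁ h₂ L hL u v huv hu hv
  refine (score_le_ncard h₁ h₂ hL u v).trans_lt ?_
  by_cases hn : u < n ∧ v < n
  · exact Nat.lt_succ_of_le (h u v hn.1 hn.2 huv hu hv)
  -- Labels outside `[0, n)` are isolated, hence have low degree vacuously but no neighbours.
  · have : nbr G u ∩ nbr G v = ∅ := by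
      ext w
      simp only [Set.mem_inter_iff, Set.mem_empty_iff_false, iff_false]
      rintro ⟨hwu, hwv⟩
      exact hn ⟨hG _ _ hwu, hG _ _ hwv⟩
    rw [this]; simp

/-- A newly added low-degree mismatch has score at least 9, so an incorrect link was already there.
Either that link has an endpoint of high degree, or the induction hypothesis applies to it. -/
theorem noLowDegreeError_of_scoreBelowThreshold {n : ℕ} {G : Multigraph}
    (h : ScoreBelowThreshold n G) : NoLowDegreeError n G := by
  intro G₁ G₂ h₁ h₂ k D ℓ h0 hrun t
  induction t with
  | zero => exact fun _ u v huv hne => absurd (h0 _ huv) hne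
  | succ t ih =>
    intro ht u v huv hne hu hv
    obtain ⟨S, hS, hbest, -⟩ := hrun t (by omega)
    rw [hS] at huv
    rcases huv with huv | huv
    · obtain ⟨t', ht', hab⟩ := ih (by omega) u v huv hne hu hv
      exact ⟨t', by omega, hab⟩
    · have hnot : ¬ AllCorrect (ℓ t) := fun hc =>
        absurd (h G₁ G₂ h₁ h₂ _ hc u v hne hu hv) (hbest u v huv).2.1.not_gt
      rw [AllCorrect] at hnot
      push Not at hnot
      obtain ⟨⟨a, b⟩, hab, hneab⟩ := hnot
      by_cases hlow : LowDegree n G a ∧ LowDegree n G b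
      · obtain ⟨t', ht', hab'⟩ := ih (by omega) a b hab hneab hlow.1 hlow.2
        exact ⟨t', by omega, hab'⟩
      · exact ⟨t, by omega, a, b, hab, hneab, not_and_or.mp hlow⟩

/-! ### The probability of few common neighbours -/

/-- The three properties of the main theorem. -/
def goodGraphs (n : ℕ) : Set Multigraph :=
  {G | FewCommonNeighbours n G ∧ ScoreBelowThreshold n G ∧ NoLowDegreeError n G}

theorem mem_goodGraphs {m n : ℕ} {f : ℕ → ℕ} (hf : Valid m (m * n) f)
    (h : FewCommonNeighbours n (graphOf m (m * n) f)) :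
    graphOf m (m * n) f ∈ goodGraphs n :=
  have h2 := scoreBelowThreshold_of_fewCommonNeighbours
    (fun _ _ hab => (lt_of_mem_graphOf hf hab).1) h
  ⟨h, h2, noLowDegreeError_of_scoreBelowThreshold h2⟩

theorem one_le_sum_joinCount {m n N u v : ℕ} (hm : 1 ≤ m) {f : ℕ → ℕ} (hf : Valid m (m * n) f)
    (hu : N ≤ u) (hv : N ≤ v) (hun : u < n) (hvn : v < n) (huv : u ≠ v)
    (h : 8 < (nbr (graphOf m (m * n) f) u ∩ nbr (graphOf m (m * n) f) v).ncard) :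
    1 ≤ ∑ c ∈ configurations N n, joinCount m f c.1.1 c.1.2 c.2 := by
  set A := nbr (graphOf m (m * n) f) u ∩ nbr (graphOf m (m * n) f) v with hA
  have hfin : A.Finite := (nbr_finite _ u).inter_of_left _
  -- Loops can make `u` or `v` a common neighbour; discarding both leaves at least seven of the
  -- nine.
  have hcard : 4 ≤ ((hfin.toFinset.erase u).erase v).card := by
    have h1 := Finset.pred_card_le_card_erase (s := hfin.toFinset) (a := u)
    have h2 := Finset.pred_card_le_card_erase (s := hfin.toFinset.erase u) (a := v)
    rw [Set.ncard_eq_toFinset_card A hfin] at h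
    omega
  obtain ⟨w, hw⟩ := Function.Embedding.exists_of_card_le_finset (α := Fin 4)
    (by simpa using hcard)
  have hw' : ∀ i, w i ≠ v ∧ w i ≠ u ∧ w i ∈ A := by
    intro i
    have := hw ⟨i, rfl⟩
    simp only [Finset.coe_erase, Set.Finite.coe_toFinset] at this
    exact ⟨this.2, this.1.2, this.1.1⟩
  have hmem : ((u, v), (w : Fin 4 → ℕ)) ∈ configurations N n := by
    rw [configurations, Finset.mem_filter, Finset.mem_product, Finset.mem_product,
      Finset.mem_Ico, Finset.mem_Ico, Fintype.mem_piFinset]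
    exact ⟨⟨⟨⟨hu, hun⟩, hv, hvn⟩, fun i =>
      Finset.mem_range.mpr (lt_of_mem_graphOf hf (hw' i).2.2.1).2⟩, huv, w.injective,
      fun i => (hw' i).2.1, fun i => (hw' i).1⟩
  refine le_trans ?_ (Finset.single_le_sum (fun c _ => joinCount_nonneg m f c.1.1 c.1.2 c.2) hmem)
  rw [← Finset.prod_const_one (s := (Finset.univ : Finset (Fin 4 × Bool)))]
  refine Finset.prod_le_prod (fun _ _ => zero_le_one) ?_
  rintro ⟨i, _ | _⟩ -
  · exact one_le_edgeCount hm hf (hw' i).2.2.2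
  · exact one_le_edgeCount hm hf (hw' i).2.2.1

/-- The union bound in pointwise form: on a bad graph one of the two sums is at least 1. A
low-degree node `x < N` contributes `log³ n / deg x ≥ 1`, as in Markov's inequality. -/
theorem one_le_indicator_add {m n N : ℕ} (hm : 1 ≤ m) {f : ℕ → ℕ} (hf : Valid m (m * n) f)
    (hn : 1 ≤ n) :
    1 ≤ (goodGraphs n).indicator 1 (graphOf m (m * n) f)
      + ((∑ x ∈ (Finset.range n).filter (· < N),
          Real.log n ^ 3 * (1 / (deg (graphOf m (m * n) f) x : ℝ)))
        + ∑ c ∈ configurations N n, joinCount m f c.1.1 c.1.2 c.2) := by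
  have hlog : 0 ≤ Real.log n := Real.log_nonneg (by exact_mod_cast hn)
  have h0 : (0 : ℝ) ≤ (goodGraphs n).indicator 1 (graphOf m (m * n) f) :=
    Set.indicator_nonneg (fun _ _ => zero_le_one) _
  have h1 : ∀ x ∈ (Finset.range n).filter (· < N),
      0 ≤ Real.log n ^ 3 * (1 / (deg (graphOf m (m * n) f) x : ℝ)) := fun x _ => by positivity
  have h1' := Finset.sum_nonneg h1
  have h2 : 0 ≤ ∑ c ∈ configurations N n, joinCount m f c.1.1 c.1.2 c.2 :=
    Finset.sum_nonneg fun c _ => joinCount_nonneg ..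
  have hold : ∀ x, x < n → x < N → LowDegree n (graphOf m (m * n) f) x →
      1 ≤ ∑ x ∈ (Finset.range n).filter (· < N),
          Real.log n ^ 3 * (1 / (deg (graphOf m (m * n) f) x : ℝ)) := by
    intro x hxn hxN hlow
    refine le_trans ?_ (Finset.single_le_sum h1
      (Finset.mem_filter.mpr ⟨Finset.mem_range.mpr hxn, hxN⟩))
    have hd := one_le_deg_graphOf f hm (Nat.mul_lt_mul_of_pos_left hxn hm)
    rw [mul_one_div, one_le_div (by exact_mod_cast hd)]
    exact hlow.le
  by_cases hgood : FewCommonNeighbours n (graphOf m (m * n) f)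
  · rw [Set.indicator_of_mem (mem_goodGraphs hf hgood), Pi.one_apply]
    linarith
  · rw [FewCommonNeighbours] at hgood
    push Not at hgood
    obtain ⟨u, v, hu, hv, huv, hlu, hlv, hc⟩ := hgood
    by_cases huN : u < N
    · have := hold u hu huN hlu
      linarith
    by_cases hvN : v < N
    · have := hold v hv hvN hlv
      linarith
    have := one_le_sum_joinCount hm hf (not_lt.mp huN) (not_lt.mp hvN) hu hv huv hc
    linarith

theorem sqrt_growth_div_le {m n N x : ℕ} (hm : 1 ≤ m) (hn : 1 ≤ n) (hx : x < N) :
    √(growth (m * (x + 1)) / growth (m * n)) ≤ 5 * m * N / (n : ℝ) ^ (1 / 4 : ℝ) := by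
  have hn' : (1 : ℝ) ≤ n := by exact_mod_cast hn
  have hm' : (1 : ℝ) ≤ m := by exact_mod_cast hm
  have hx' : (x : ℝ) + 1 ≤ N := by exact_mod_cast hx
  have hx0 : (0 : ℝ) ≤ x := Nat.cast_nonneg x
  have hmN : (m : ℝ) * (x + 1) ≤ m * N := by gcongr
  have hmN1 : 1 ≤ (m : ℝ) * N := by nlinarith
  have g1 := growth_pos (m * (x + 1))
  have g2 := growth_pos (m * n)
  -- Deliberately crude: `growth ^ 2 ≤ 4mN + 1 ≤ 5mN ≤ (5mN) ^ 2`. Powers of `N` are only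
  -- logarithmic in `n`.
  have h1 : growth (m * (x + 1)) ≤ 5 * m * N := by
    refine (pow_le_pow_iff_left₀ g1.le (by positivity) two_ne_zero).mp ?_
    refine (growth_sq_le _).trans ?_
    push_cast
    nlinarith
  have h2 : √n ≤ growth (m * n) := by
    refine (Real.sqrt_le_sqrt ?_).trans ((Real.sqrt_le_sqrt (le_growth_sq (m * n))).trans
      (Real.sqrt_sq g2.le).le)
    push_cast
    nlinarith
  have h3 : (n : ℝ) ^ (1 / 4 : ℝ) = √√n := by
    rw [Real.sqrt_eq_rpow, Real.sqrt_eq_rpow, ← Real.rpow_mul (by positivity)]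
    norm_num
  rw [Real.sqrt_div g1.le, h3]
  have h4 : √(growth (m * (x + 1))) ≤ 5 * m * N := by
    rw [Real.sqrt_le_left (by positivity)]
    nlinarith
  gcongr

theorem one_sub_le_expect {m n N : ℕ} (hm : 1 ≤ m) (hn : 1 ≤ n) (hN : 1 ≤ N) :
    1 - (N * (Real.log n ^ 3 * (5 * m * N / (n : ℝ) ^ (1 / 4 : ℝ)))
        + (m * (2 * (2 * m + 8))) ^ 8 * ((1 / (N : ℝ)) ^ 2 * (1 + Real.log n) ^ 4))
      ≤ expect m (m * n) fun f => (goodGraphs n).indicator 1 (graphOf m (m * n) f) := by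
  have hlog : 0 ≤ Real.log n := Real.log_nonneg (by exact_mod_cast hn)
  have h1 := expect_mono (m := m) (s := m * n) fun f hf => one_le_indicator_add (N := N) hm hf hn
  rw [expect_const, expect_add, expect_add, expect_sum] at h1
  have h2 := expect_sum_joinCount_le (n := n) hm hN
  have h3 : ∑ x ∈ (Finset.range n).filter (· < N), expect m (m * n) (fun f =>
      Real.log n ^ 3 * (1 / (deg (graphOf m (m * n) f) x : ℝ)))
      ≤ N * (Real.log n ^ 3 * (5 * m * N / (n : ℝ) ^ (1 / 4 : ℝ))) := by
    have hcard : ((Finset.range n).filter (· < N)).card ≤ N := by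
      refine (Finset.card_le_card (t := Finset.range N) fun x hx => ?_).trans
        (Finset.card_range N).le
      exact Finset.mem_range.mpr (Finset.mem_filter.mp hx).2
    refine (Finset.sum_le_card_nsmul _ _ (Real.log n ^ 3 * (5 * m * N / (n : ℝ) ^ (1 / 4 : ℝ)))
      fun x hx => ?_).trans ?_
    · rw [Finset.mem_filter, Finset.mem_range] at hx
      rw [expect_mul_left]
      refine mul_le_mul_of_nonneg_left ?_ (by positivity)
      exact (expect_inv_deg_le hm (Nat.mul_le_mul_left m hx.1)).trans
        (sqrt_growth_div_le hm hn hx.2)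
    · rw [nsmul_eq_mul]
      gcongr
  linarith

theorem expect_indicator_le_one (m s : ℕ) (A : Set Multigraph) :
    expect m s (fun f => A.indicator 1 (graphOf m s f)) ≤ 1 := by
  refine (expect_mono fun f _ => ?_).trans (expect_const m s 1).le
  exact Set.indicator_le_self' (fun _ _ => zero_le_one) _

theorem tendsto_error (m : ℕ) :
    Tendsto (fun n : ℕ => 1 - ((⌈Real.log n ^ 3⌉₊ : ℝ) * (Real.log n ^ 3
        * (5 * m * (⌈Real.log n ^ 3⌉₊ : ℝ) / (n : ℝ) ^ (1 / 4 : ℝ)))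
        + (m * (2 * (2 * m + 8))) ^ 8
          * ((1 / (⌈Real.log n ^ 3⌉₊ : ℝ)) ^ 2 * (1 + Real.log n) ^ 4))) atTop (𝓝 1) := by
  have hlog : Tendsto (fun n : ℕ => Real.log n) atTop atTop :=
    Real.tendsto_log_atTop.comp tendsto_natCast_atTop_atTop
  set C : ℝ := (m * (2 * (2 * m + 8))) ^ 8 with hC
  have hC0 : 0 ≤ C := by positivity
  have h1 : Tendsto (fun n : ℕ => Real.log n ^ 9 / (n : ℝ) ^ (1 / 4 : ℝ)) atTop (𝓝 0) := by
    have := (isLittleO_log_rpow_rpow_atTop 9 (show (0 : ℝ) < 1 / 4 by norm_num)).tendsto_div_nhds_zero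
    refine (this.comp tendsto_natCast_atTop_atTop).congr fun n => ?_
    simp only [Function.comp_apply]
    norm_cast
  have h2 : Tendsto (fun n : ℕ => (Real.log n ^ 2)⁻¹) atTop (𝓝 0) :=
    ((tendsto_pow_atTop two_ne_zero).comp hlog).inv_tendsto_atTop
  have h3 : Tendsto (fun n : ℕ => 20 * m * (Real.log n ^ 9 / (n : ℝ) ^ (1 / 4 : ℝ))
      + 16 * C * (Real.log n ^ 2)⁻¹) atTop (𝓝 0) := by
    simpa using (h1.const_mul (20 * (m : ℝ))).add (h2.const_mul (16 * C))
  have h4 : Tendsto (fun n : ℕ => 1 - (20 * m * (Real.log n ^ 9 / (n : ℝ) ^ (1 / 4 : ℝ))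
      + 16 * C * (Real.log n ^ 2)⁻¹)) atTop (𝓝 1) := by
    simpa using h3.const_sub 1
  refine tendsto_of_tendsto_of_tendsto_of_le_of_le' h4 tendsto_const_nhds ?_ ?_
  -- For `L = log n ≥ 1` the cutoff lies in `[L³, 2L³]` and `1 + L ≤ 2L`; this produces the
  -- constants `20 = 2 · 5 · 2` and `16 = 2⁴`.
  · filter_upwards [hlog.eventually_ge_atTop 1] with n hn
    set L := Real.log n
    set N : ℝ := (⌈L ^ 3⌉₊ : ℝ) with hN
    have hL0 : 0 < L := by linarith
    have hN1 : L ^ 3 ≤ N := Nat.le_ceil _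
    have hL3 : 1 ≤ L ^ 3 := one_le_pow₀ hn
    have hN2 : N ≤ 2 * L ^ 3 := by
      have := (Nat.ceil_lt_add_one (show 0 ≤ L ^ 3 by positivity)).le
      linarith
    have hN0 : 0 < N := by linarith
    have e1 : N * (L ^ 3 * (5 * m * N / (n : ℝ) ^ (1 / 4 : ℝ)))
        ≤ 20 * m * (L ^ 9 / (n : ℝ) ^ (1 / 4 : ℝ)) := by
      calc _ ≤ 2 * L ^ 3 * (L ^ 3 * (5 * m * (2 * L ^ 3) / (n : ℝ) ^ (1 / 4 : ℝ))) := by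
            gcongr
        _ = _ := by ring
    have e2 : C * ((1 / N) ^ 2 * (1 + L) ^ 4) ≤ 16 * C * (L ^ 2)⁻¹ := by
      calc _ ≤ C * ((1 / L ^ 3) ^ 2 * (2 * L) ^ 4) := by
            have : 1 + L ≤ 2 * L := by linarith
            gcongr
        _ = _ := by field_simp; ring
    linarith
  · refine Eventually.of_forall fun n => ?_
    have : 0 ≤ Real.log n := Real.log_natCast_nonneg n
    have : 0 ≤ (⌈Real.log n ^ 3⌉₊ : ℝ) * (Real.log n ^ 3
        * (5 * m * (⌈Real.log n ^ 3⌉₊ : ℝ) / (n : ℝ) ^ (1 / 4 : ℝ)))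
        + C * ((1 / (⌈Real.log n ^ 3⌉₊ : ℝ)) ^ 2 * (1 + Real.log n) ^ 4) := by positivity
    linarith

end PAMatching

theorem mainTheorem3 (m : ℕ) (hm : 1 ≤ m) :
    Filter.Tendsto
      (fun n : ℕ => (PAMatching.prefAttach m n).toOuterMeasure
        {G : PAMatching.Multigraph |
          PAMatching.FewCommonNeighbours n G ∧
          PAMatching.ScoreBelowThreshold n G ∧
          PAMatching.NoLowDegreeError n G})
      Filter.atTop (nhds 1) := by
  have h : Tendsto (fun n : ℕ => PAMatching.expect m (m * n) fun f =>
      (PAMatching.goodGraphs n).indicator 1 (PAMatching.graphOf m (m * n) f)) atTop (𝓝 1) := by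
    refine tendsto_of_tendsto_of_tendsto_of_le_of_le' (PAMatching.tendsto_error m)
      tendsto_const_nhds ?_ (Eventually.of_forall fun n =>
        PAMatching.expect_indicator_le_one m _ _)
    -- For `n ≥ 2` the logarithm is positive, so the cutoff `⌈log³ n⌉` is at least 1.
    filter_upwards [eventually_ge_atTop 2] with n hn
    refine PAMatching.one_sub_le_expect hm (by omega) (Nat.ceil_pos.mpr ?_)
    have : 0 < Real.log n := Real.log_pos (by exact_mod_cast hn)
    positivity
  have h' := (ENNReal.continuous_ofReal.tendsto 1).comp h
  rw [ENNReal.ofReal_one] at h'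
  exact h'.congr fun n => (PAMatching.toOuterMeasure_prefAttach m n hm _).symm
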